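/- Let $n\ge 0$ and let $G=([n],E)$ be a finite simple graph. For $\sigma\subseteq[n]$ let $G[\sigma]$ be the induced subgraph and $E(G[\sigma])$ its edge set. **Definitions.** A \emph{connected partition} of $G$ is a partition $\Sigma$ of $[n]$ such that $G[\sigma]$ is connected for every $\sigma\in\Sigma$. Its \emph{partition graph} $G^\Sigma$ has vertex set $\Sigma$, and distinct $\sigma,\rho\in\Sigma$ are adjacent if and only if some edge of $G$ joins a vertex of $\sigma$ to a vertex of $\rho$. A \emph{partial acyclic orientation} (p.a.o.) $O$ of $G$ is an assignment to each edge $\{u,v\}\in E$ of one of $\{u,v\}$ (undirected), $(u,v)$, $(v,u)$ that arises from some connected partition $\Sigma$ and some acyclic orientation $O^\Sigma$ of $G^\Sigma$ (every edge directed, no directed cycle) as follows: edges inside a part of $\Sigma$ are undirected, and an edge $\{u,v\}$ with $u\in\sigma$, $v\in\rho$, $\sigma\ne\rho$ is sent to $(u,v)$ if $O^\Sigma$ directs $\{\sigma,\rho\}$ as $(\sigma,\rho)$. The pair $(\Sigma,O^\Sigma)$ is determined by $O$. Regard $O^\Sigma$ as a partial order on $\Sigma$, with $\sigma\le\rho$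 if and only if there is a directed path (possibly of length $0$) from $\sigma$ to $\rho$, and put $$J_G(O)=\Big\{\bigcup_{\sigma\in I}\sigma \;:\; I \text{ an order ideal (down-set) of } O^\Sigma\Big\}\subseteq 2^{[n]},\qquad \dim_G(O)=n-|\Sigma|.$$ Let $\mathscr Z_G$ be the abstract cell complex whose cells are the p.a.o.'s of $G$, with face order $O_1\preceq O_2$ if and only if $J_G(O_2)\subseteq J_G(O_1)$, and with dimension function $\dim_G$. **Theorem.** Let $$\mathcal Z_G=\Big\{x\in\mathbb R^{n} : \sum_{i\in[n]}x_i=n+|E|,\ \ \sum_{i\in\sigma}x_i\ge|\sigma|+|E(G[\sigma])|\ \text{ for all }\sigma\subseteq[n]\Big\}.$$ 1. $\mathcal Z_G$ is a polytope, and the complex of its non-empty faces ($\mathcal Z_G$ included) is a polytopal complex realization of $\mathscr Z_G$: it is a polytopal complex, and there is a bijection $O\mapsto F_O$ from the p.a.o.'s of $G$ onto the non-empty faces of $\mathcal Z_G$ such that $O_1\preceq O_2$ if and only if $F_{O_1}\subseteq F_{O_2}$, and such that the affine dimension of $F_O$ is $\dim_G(O)$. 2. Let $\mathbf d_G$ be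 the degree vector of $G$, $\mathbf 1$ the all-ones vector, and $\mathrm{Zon}(G)=\sum_{\{i,j\}\in E}[e_i-e_j,\,e_j-e_i]$ (Minkowski sum of segments) the graphical zonotope. Then $$\mathcal Z_G=\tfrac12\,\mathrm{Zon}(G)+\tfrac12\,\mathbf d_G+\mathbf 1 .$$ -/

import Mathlib

open scoped Pointwise

noncomputable section

section Orientations

variable {V : Type*}

/-- An orientation of a simple graph `G`, with undirected edges allowed: `dir u v` says that the
edge `{u, v}` is sent to the ordered pair `(u, v)`. An edge `{u, v}` with neither `dir u v` nor
`dir v u` is left undirected (it is sent to itself). -/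
@[ext]
structure GraphOrientation (G : SimpleGraph V) where
  dir : V → V → Prop
  adj_of_dir : ∀ u v, dir u v → G.Adj u v
  asymm : ∀ u v, dir u v → ¬ dir v u

/-- An acyclic orientation of `G`: every edge is directed and there is no directed cycle. -/
structure GraphOrientation.IsAcyclic {G : SimpleGraph V} (O : GraphOrientation G) : Prop where
  total : ∀ u v, G.Adj u v → O.dir u v ∨ O.dir v u
  noCycle : ∀ u, ¬ Relation.TransGen O.dir u u

variable [Fintype V] [DecidableEq V]

/-- A partition of the vertex set all of whose parts induce connected subgraphs. -/
def IsConnectedPartition (G : SimpleGraph V) (P : Finpartition (Finset.univ : Finset V)) : Prop :=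
  ∀ σ ∈ P.parts, (G.induce (σ : Set V)).Connected

/-- The partition graph: its vertices are the parts, and two different parts are adjacent when
some edge of `G` joins them. -/
def partitionGraph (G : SimpleGraph V) (P : Finpartition (Finset.univ : Finset V)) :
    SimpleGraph {σ : Finset V // σ ∈ P.parts} where
  Adj σ ρ := σ ≠ ρ ∧ ∃ u ∈ σ.1, ∃ v ∈ ρ.1, G.Adj u v
  symm := ⟨by
    rintro σ ρ ⟨hne, u, hu, v, hv, huv⟩
    exact ⟨hne.symm, v, hv, u, hu, huv.symm⟩⟩
  loopless := ⟨fun σ h => h.1 rfl⟩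

/-- A connected partition of `G` with an acyclic orientation of its partition graph. -/
structure OrientedPartition (G : SimpleGraph V) where
  partition : Finpartition (Finset.univ : Finset V)
  connected : IsConnectedPartition G partition
  orient : GraphOrientation (partitionGraph G partition)
  acyclic : orient.IsAcyclic

/-- `D.Induces O`: the orientation `O` of `G` is obtained from `D`. Edges inside a part are
undirected in `O`, and edges between two different parts are directed as the parts are in `D`. -/
def OrientedPartition.Induces {G : SimpleGraph V} (D : OrientedPartition G)
    (O : GraphOrientation G) : Prop :=
  ∀ u v, G.Adj u v → ∀ σ ρ : {σ : Finset V // σ ∈ D.partition.parts}, u ∈ σ.1 → v ∈ ρ.1 →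
    (σ = ρ → ¬ O.dir u v ∧ ¬ O.dir v u) ∧ (D.orient.dir σ ρ → O.dir u v)

/-- The partial acyclic orientations (p.a.o.'s) of `G`. -/
def PAO (G : SimpleGraph V) : Type _ :=
  {O : GraphOrientation G // ∃ D : OrientedPartition G, D.Induces O}

namespace OrientedPartition

variable {G : SimpleGraph V} {D D' : OrientedPartition G} {O : GraphOrientation G}

lemma Induces.undirected_iff (h : D.Induces O) {u v : V} (huv : G.Adj u v) :
    (¬ O.dir u v ∧ ¬ O.dir v u) ↔ D.partition.part u = D.partition.part v := by
  have hu := D.partition.mem_part (Finset.mem_univ u)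
  have hv := D.partition.mem_part (Finset.mem_univ v)
  have pu := D.partition.part_mem.2 (Finset.mem_univ u)
  have pv := D.partition.part_mem.2 (Finset.mem_univ v)
  constructor
  · rintro ⟨h1, h2⟩
    by_contra hne
    have hadj : (partitionGraph G D.partition).Adj ⟨_, pu⟩ ⟨_, pv⟩ :=
      ⟨fun e => hne (congrArg Subtype.val e), u, hu, v, hv, huv⟩
    rcases D.acyclic.total _ _ hadj with hd | hd
    · exact h1 ((h u v huv ⟨_, pu⟩ ⟨_, pv⟩ hu hv).2 hd)
    · exact h2 ((h v u huv.symm ⟨_, pv⟩ ⟨_, pu⟩ hv hu).2 hd)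
  · intro e
    exact (h u v huv ⟨_, pu⟩ ⟨_, pv⟩ hu hv).1 (Subtype.ext e)

lemma Induces.part_eq_of_part_eq (h : D.Induces O) (h' : D'.Induces O) {u v : V}
    (huv : D.partition.part u = D.partition.part v) :
    D'.partition.part u = D'.partition.part v := by
  have hv := D.partition.mem_part (Finset.mem_univ v)
  have hu : u ∈ D.partition.part v := huv ▸ D.partition.mem_part (Finset.mem_univ u)
  have pv := D.partition.part_mem.2 (Finset.mem_univ v)
  have key : ∀ a b : {x : V // x ∈ (D.partition.part v : Set V)},
      (G.induce (D.partition.part v : Set V)).Walk a b →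
        D'.partition.part a.1 = D'.partition.part b.1 := by
    intro a b w
    induction w with
    | nil => rfl
    | @cons a b c hab _ ih =>
      have hab' : G.Adj a.1 b.1 := hab
      have e : D.partition.part a.1 = D.partition.part b.1 := by
        rw [D.partition.part_eq_of_mem pv a.2, D.partition.part_eq_of_mem pv b.2]
      exact ((h'.undirected_iff hab').1 ((h.undirected_iff hab').2 e)).trans ih
  obtain ⟨w⟩ := (D.connected _ pv).preconnected ⟨u, hu⟩ ⟨v, hv⟩
  exact key _ _ w

lemma Induces.partition_eq (h : D.Induces O) (h' : D'.Induces O) :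
    D.partition = D'.partition := by
  have hpart : ∀ u, D.partition.part u = D'.partition.part u := by
    intro u
    ext v
    rw [D.partition.mem_part_iff_part_eq_part (Finset.mem_univ v) (Finset.mem_univ u),
      D'.partition.mem_part_iff_part_eq_part (Finset.mem_univ v) (Finset.mem_univ u)]
    exact ⟨fun e => h.part_eq_of_part_eq h' e, fun e => h'.part_eq_of_part_eq h e⟩
  ext σ
  constructor
  · intro hσ
    obtain ⟨u, hu⟩ := D.partition.nonempty_of_mem_parts hσ
    rw [← D.partition.part_eq_of_mem hσ hu, hpart u]
    exact D'.partition.part_mem.2 (Finset.mem_univ u)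
  · intro hσ
    obtain ⟨u, hu⟩ := D'.partition.nonempty_of_mem_parts hσ
    rw [← D'.partition.part_eq_of_mem hσ hu, ← hpart u]
    exact D.partition.part_mem.2 (Finset.mem_univ u)

/-- A p.a.o. determines its connected partition and the acyclic orientation of the partition
graph. -/
theorem Induces.unique (h : D.Induces O) (h' : D'.Induces O) : D = D' := by
  have e := h.partition_eq h'
  obtain ⟨P, hP, Q, hQ⟩ := D
  obtain ⟨P', hP', Q', hQ'⟩ := D'
  obtain rfl : P = P' := e
  have key : ∀ (A B : GraphOrientation (partitionGraph G P)) (hA : A.IsAcyclic)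
      (hB : B.IsAcyclic), (OrientedPartition.mk P hP A hA).Induces O →
      (OrientedPartition.mk P hP B hB).Induces O → ∀ σ ρ, A.dir σ ρ → B.dir σ ρ := by
    intro A B hA hB iA iB σ ρ hd
    have hadj := A.adj_of_dir _ _ hd
    obtain ⟨-, u, hu, v, hv, huv⟩ := id hadj
    rcases hB.total _ _ hadj with h1 | h1
    · exact h1
    · exact absurd ((iB v u huv.symm ρ σ hv hu).2 h1)
        (O.asymm _ _ ((iA u v huv σ ρ hu hv).2 hd))
  obtain rfl : Q = Q' := by
    ext σ ρ
    exact ⟨key Q Q' hQ hQ' h h' σ ρ, key Q' Q hQ' hQ h' h σ ρ⟩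
  rfl

/-- The order-ideal lattice, as a collection of subsets of `V`: the unions `⋃ σ ∈ I, σ` where `I`
is an order ideal (down-set) of the set of parts, ordered by the reflexive-transitive closure of
the acyclic orientation (`σ` is below `ρ` when there is a directed path from `σ` to `ρ`). -/
def idealSets (D : OrientedPartition G) : Set (Set V) :=
  {S | ∃ I : Set {σ : Finset V // σ ∈ D.partition.parts},
    (∀ σ ρ, Relation.ReflTransGen D.orient.dir σ ρ → ρ ∈ I → σ ∈ I) ∧
    S = ⋃ σ ∈ I, (σ.1 : Set V)}

end OrientedPartition

namespace PAO

variable {G : SimpleGraph V}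

/-- The connected partition and acyclic orientation of its partition graph associated with a
p.a.o.; they are unique by `OrientedPartition.Induces.unique`. -/
def oriented (O : PAO G) : OrientedPartition G := O.2.choose

lemma oriented_induces (O : PAO G) : O.oriented.Induces O.1 := O.2.choose_spec

/-- The order-ideal lattice `J_G(O)`, as a collection of subsets of `V`. -/
def idealLattice (O : PAO G) : Set (Set V) := O.oriented.idealSets

/-- The dimension `|V| - |Σ|`, where `Σ` is the connected partition associated with `O`. -/
def dim (O : PAO G) : ℕ := Fintype.card V - O.oriented.partition.parts.card

/-- The face order on p.a.o.'s: reverse inclusion of order-ideal lattices. -/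
instance : LE (PAO G) := ⟨fun O₁ O₂ => O₂.idealLattice ⊆ O₁.idealLattice⟩

end PAO

end Orientations

section Polytopes

variable {E : Type*} [AddCommGroup E] [Module ℝ E] [TopologicalSpace E]

/-- A polytope: the convex hull of a finite set of points. -/
def IsPolytope (P : Set E) : Prop := ∃ s : Finset E, P = convexHull ℝ (s : Set E)

/-- The non-empty faces of `P`, `P` itself included: the sets of maximizers over `P` of a linear
functional. -/
def faces (P : Set E) : Set (Set E) := {F | F.Nonempty ∧ IsExposed ℝ P F}

/-- A polytopal complex, given by its non-empty cells: a finite collection of non-empty polytopes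
that is closed under taking non-empty faces, in which two cells that meet do so in a common
face. -/
structure IsPolytopalComplex (C : Set (Set E)) : Prop where
  finite : C.Finite
  nonempty : ∀ P ∈ C, P.Nonempty
  polytope : ∀ P ∈ C, IsPolytope P
  face_mem : ∀ P ∈ C, ∀ F ∈ faces P, F ∈ C
  inter : ∀ P ∈ C, ∀ Q ∈ C, (P ∩ Q).Nonempty → P ∩ Q ∈ faces P ∧ P ∩ Q ∈ faces Q

/-- `C` is a polytopal complex realization of the abstract cell complex with set of cells `Z`,
face order `≤` and dimension function `dim`: `C` is a polytopal complex whose cells, ordered by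
inclusion, correspond to `Z` so that order and (affine) dimension agree. -/
def IsPolytopalRealization (C : Set (Set E)) (Z : Type*) [LE Z] (dim : Z → ℕ) : Prop :=
  IsPolytopalComplex C ∧
    ∃ e : Z ≃ C, (∀ a b : Z, a ≤ b ↔ (e a : Set E) ⊆ (e b : Set E)) ∧
      ∀ a : Z, Module.finrank ℝ (vectorSpan ℝ (e a : Set E)) = dim a

end Polytopes

section Zonotopes

variable {V : Type*} [Fintype V] [DecidableEq V]

/-- The polytope of all `x` with `∑ x_i = |V| + |E|` and `∑_{i ∈ σ} x_i ≥ |σ| + |E(G[σ])|` for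
every set `σ` of vertices. -/
def cleanZonotope (G : SimpleGraph V) : Set (V → ℝ) :=
  {x | ∑ i, x i = (Fintype.card V : ℝ) + (G.edgeSet.ncard : ℝ) ∧
    ∀ σ : Finset V,
      (σ.card : ℝ) + ((G.induce (σ : Set V)).edgeSet.ncard : ℝ) ≤ ∑ i ∈ σ, x i}

/-- The segment `[e_i - e_j, e_j - e_i]` of the unordered pair `{i, j}`. -/
def edgeSegment : Sym2 V → Set (V → ℝ) :=
  Sym2.lift ⟨fun i j => segment ℝ (Pi.single i 1 - Pi.single j 1 : V → ℝ)
    (Pi.single j 1 - Pi.single i 1), fun _ _ => segment_symm ℝ _ _⟩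

/-- The graphical zonotope: the Minkowski sum of the segments of the edges of `G`. -/
def graphicalZonotope (G : SimpleGraph V) : Set (V → ℝ) :=
  ∑ e ∈ G.edgeSet.toFinite.toFinset, edgeSegment e

/-- The degree vector of `G`. -/
def degreeVector (G : SimpleGraph V) : V → ℝ := fun i => ((G.neighborSet i).ncard : ℝ)

end Zonotopes

end

/-!
Everything rests on a parametrization of the polytope. A *fractional orientation* `t` of `G` lets
each edge `{u, v}` divide a unit weight between its ends, sending `t u v` to `v` and `t v u` to `u`;
its *load* gives each vertex one unit plus what the edges send to it.

The loads are exactly the points of `½ Zon(G) + ½ d + 1`, since the segment of an edge records how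
its weight is divided (`mem_translate_zonotope_iff`). The sum of a load over a set `S` exceeds
`|S| + |E(G[S])|` by the total weight sent into `S` by edges from outside
(`IsFracOrientation.sum_load`), so loads lie in the polytope. Conversely, for any
`c : V → ℝ` directing edges towards larger values of `c`, and splitting them evenly in case of a tie,
makes every sublevel set of `c` tight. By Abel summation the resulting load maximizes `c` over the
whole polytope (`sum_mul_le_sum_mul_load`). By Hahn-Banach separation, every point of the polytope is a load
(`exists_load_eq_of_mem`). Hence the polytope is the translated zonotope, and in particular the
convex hull of a finite set.

The face maximizing `c` consists of the loads for which every edge with different values of `c` at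
its ends is directed to the larger one (`load_mem_toExposed_iff`). The face of a p.a.o. `O`, defined
by tightness of the sets in `J_G(O)`, consists of the loads for which every directed edge of `O` is
directed in the same way (`PAO.load_mem_face_iff`). These two kinds of face coincide when `O` orients
the edges as `c` does, and each `O` comes from some `c`
(`OrientedPartition.Induces.exists_height`) and each `c` from some `O` (`PAO.exists_dir_iff_lt`).
The load that splits all undirected edges of `O` evenly is tight at no sets but those of `J_G(O)`
(`PAO.isTight_center_iff`), so inclusion of faces is reverse inclusion of the lattices; the lattice
determines `O` because a directed edge is one that leaves some set of the lattice (`PAO.dir_iff`).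

On the face of `O` the sums over the parts are constant, and along an undirected edge `{u, v}` one can
move in direction `e_u - e_v`. As the parts are connected, the direction space of the face is the
space of vectors whose sums over the parts vanish (`PAO.vectorSpan_face`), of dimension `n - |Σ|`.
That the faces of any polytope form a polytopal complex is
`IsPolytope.isPolytopalComplex_faces`.
-/

noncomputable section

/-! ### Faces of polytopes -/

section PolytopeFaces

variable {E : Type*} [AddCommGroup E] [Module ℝ E]

lemma IsPolytope.convex {P : Set E} (hP : IsPolytope P) : Convex ℝ P := by
  obtain ⟨s, rfl⟩ := hP
  exact convex_convexHull ℝ _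

lemma isPolytope_convexHull {s : Set E} (hs : s.Finite) : IsPolytope (convexHull ℝ s) :=
  ⟨hs.toFinset, by rw [hs.coe_toFinset]⟩

lemma isPolytope_singleton (x : E) : IsPolytope ({x} : Set E) := by
  simpa using isPolytope_convexHull (Set.finite_singleton x)

lemma IsPolytope.add {P Q : Set E} (hP : IsPolytope P) (hQ : IsPolytope Q) :
    IsPolytope (P + Q) := by
  obtain ⟨s, rfl⟩ := hP
  obtain ⟨t, rfl⟩ := hQ
  rw [← convexHull_add]
  exact isPolytope_convexHull (s.finite_toSet.add t.finite_toSet)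

lemma IsPolytope.smul {P : Set E} (hP : IsPolytope P) (a : ℝ) : IsPolytope (a • P) := by
  obtain ⟨s, rfl⟩ := hP
  rw [← convexHull_smul]
  exact isPolytope_convexHull s.finite_toSet.smul_set

lemma IsPolytope.sum {ι : Type*} (s : Finset ι) {P : ι → Set E}
    (hP : ∀ i ∈ s, IsPolytope (P i)) : IsPolytope (∑ i ∈ s, P i) :=
  Finset.sum_induction P IsPolytope (fun _ _ h h' => h.add h') (isPolytope_singleton 0) hP

lemma isPolytope_segment (x y : E) : IsPolytope (segment ℝ x y) := by
  rw [← convexHull_pair]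
  exact isPolytope_convexHull (Set.toFinite _)

variable [TopologicalSpace E] [IsTopologicalAddGroup E] [ContinuousSMul ℝ E]

lemma IsPolytope.isCompact {P : Set E} (hP : IsPolytope P) : IsCompact P := by
  obtain ⟨s, rfl⟩ := hP
  exact s.finite_toSet.isCompact_convexHull ℝ

variable [T2Space E] [LocallyConvexSpace ℝ E]

/-- An exposed face of the convex hull of a finite set `s` is spanned by the points of `s` it
contains: by Krein-Milman it is the closed hull of its extreme points, and these lie in `s`. -/
lemma IsExposed.eq_convexHull_inter {s F : Set E} (hs : s.Finite)
    (hF : IsExposed ℝ (convexHull ℝ s) F) : F = convexHull ℝ (s ∩ F) := by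
  have hconv : Convex ℝ F := hF.convex (convex_convexHull ℝ s)
  have hcomp : IsCompact F := hF.isCompact (hs.isCompact_convexHull ℝ)
  refine Set.Subset.antisymm ?_ (convexHull_min Set.inter_subset_right hconv)
  have hsub : F.extremePoints ℝ ⊆ s ∩ F := fun x hx =>
    ⟨extremePoints_convexHull_subset (hF.isExtreme.extremePoints_subset_extremePoints hx), hx.1⟩
  calc F = closure (convexHull ℝ (F.extremePoints ℝ)) :=
        (closure_convexHull_extremePoints hcomp hconv).symm
    _ ⊆ closure (convexHull ℝ (s ∩ F)) := closure_mono (convexHull_mono hsub)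
    _ = convexHull ℝ (s ∩ F) :=
        ((hs.subset Set.inter_subset_left).isClosed_convexHull ℝ).closure_eq

/-- A face of a face of a polytope is a face. If `l` exposes `F` in `P` and `m` exposes `F'` in
`F`, then `N • l + m` exposes `F'` in `P` as soon as `N` is large compared with the finitely many
vertices outside `F`. -/
lemma mem_faces_trans {P F F' : Set E} (hP : IsPolytope P) (hF : F ∈ faces P)
    (hF' : F' ∈ faces F) : F' ∈ faces P := by
  obtain ⟨s, rfl⟩ := hP
  obtain ⟨hFne, hFexp⟩ := hF
  obtain ⟨hFne', hFexp'⟩ := hF'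
  refine ⟨hFne', fun _ => ?_⟩
  have hFsub := hFexp.subset
  have hFsub' := hFexp'.subset
  have hconv' : Convex ℝ F' := hFexp'.convex (hFexp.convex (convex_convexHull ℝ _))
  obtain ⟨l, hl⟩ := hFexp hFne
  obtain ⟨m, hm⟩ := hFexp' hFne'
  obtain ⟨x₀, hx₀⟩ := hFne'
  have hx₀F := hFsub' hx₀
  have hx₀l : ∀ y ∈ convexHull ℝ (s : Set E), l y ≤ l x₀ := by
    rw [hl] at hx₀F
    exact hx₀F.2
  have hx₀m : ∀ y ∈ F, m y ≤ m x₀ := by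
    rw [hm] at hx₀
    exact hx₀.2
  have hlF : ∀ y ∈ F, l y = l x₀ := by
    intro y hy
    refine le_antisymm (hx₀l y (hFsub hy)) ?_
    rw [hl] at hy
    exact hy.2 _ (hFsub hx₀F)
  have hN : ∀ᶠ N : ℝ in Filter.atTop, ∀ v ∈ s, v ∉ F → N * l v + m v < N * l x₀ + m x₀ := by
    rw [Filter.eventually_all_finset]
    intro v hv
    by_cases hvF : v ∈ F
    · exact Filter.Eventually.of_forall fun N h => absurd hvF h
    · have hvP := subset_convexHull ℝ (s : Set E) hv
      have hlt : l v < l x₀ := by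
        refine lt_of_le_of_ne (hx₀l v hvP) fun h => hvF ?_
        rw [hl]
        exact ⟨hvP, fun y hy => h ▸ hx₀l y hy⟩
      filter_upwards [Filter.eventually_gt_atTop ((m v - m x₀) / (l x₀ - l v))] with N hN _
      rw [div_lt_iff₀ (sub_pos.2 hlt)] at hN
      linarith
  obtain ⟨N, hN⟩ := hN.exists
  set g : StrongDual ℝ E := N • l + m
  have hgval : ∀ x, g x = N * l x + m x := fun x => rfl
  have hgs : ∀ v ∈ s, g v ≤ g x₀ ∧ (g v = g x₀ → v ∈ F') := by
    intro v hv
    rw [hgval, hgval]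
    by_cases hvF : v ∈ F
    · rw [hlF v hvF]
      refine ⟨by linarith [hx₀m v hvF], fun h => ?_⟩
      have hmv : m v = m x₀ := by linarith
      rw [hm]
      exact ⟨hvF, fun y hy => hmv ▸ hx₀m y hy⟩
    · have := hN v hv hvF
      exact ⟨this.le, fun h => absurd h this.ne⟩
  have hgP : ∀ y ∈ convexHull ℝ (s : Set E), g y ≤ g x₀ := by
    intro y hy
    have hsub : convexHull ℝ (s : Set E) ⊆ {x | g x ≤ g x₀} :=
      convexHull_min (fun v hv => (hgs v hv).1)
        (convex_halfSpace_le g.toLinearMap.isLinear (g x₀))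
    exact hsub hy
  refine ⟨g, Set.Subset.antisymm (fun x hx => ?_) ?_⟩
  · have hxF := hFsub' hx
    refine ⟨hFsub hxF, fun y hy => (hgP y hy).trans ?_⟩
    rw [hgval, hgval, hlF x hxF]
    rw [hm] at hx
    linarith [hx.2 x₀ hx₀F]
  · have hexp : IsExposed ℝ (convexHull ℝ (s : Set E)) (g.toExposed (convexHull ℝ (s : Set E))) :=
      ContinuousLinearMap.toExposed.isExposed
    change g.toExposed (convexHull ℝ (s : Set E)) ⊆ F'
    rw [hexp.eq_convexHull_inter s.finite_toSet]
    refine convexHull_min ?_ hconv'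
    rintro v ⟨hv, -, hvmax⟩
    exact (hgs v hv).2 (le_antisymm (hgs v hv).1 (hvmax _ (hFsub hx₀F)))

/-- The non-empty faces of a polytope form a polytopal complex. -/
theorem IsPolytope.isPolytopalComplex_faces {P : Set E} (hP : IsPolytope P) :
    IsPolytopalComplex (faces P) where
  finite := by
    obtain ⟨s, rfl⟩ := hP
    refine (s.finite_toSet.finite_subsets.image (convexHull ℝ)).subset ?_
    rintro F ⟨-, hF⟩
    exact ⟨(s : Set E) ∩ F, Set.inter_subset_left, (hF.eq_convexHull_inter s.finite_toSet).symm⟩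
  nonempty := fun F hF => hF.1
  polytope := by
    rintro F ⟨-, hF⟩
    obtain ⟨s, rfl⟩ := hP
    rw [hF.eq_convexHull_inter s.finite_toSet]
    exact isPolytope_convexHull (s.finite_toSet.subset Set.inter_subset_left)
  face_mem := fun F hF F' hF' => mem_faces_trans hP hF hF'
  inter := by
    rintro F ⟨-, hF⟩ F' ⟨-, hF'⟩ hne
    have hexp := hF.inter hF'
    exact ⟨⟨hne, hexp.mono hF.subset Set.inter_subset_left⟩,
      ⟨hne, hexp.mono hF'.subset Set.inter_subset_right⟩⟩

end PolytopeFaces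

/-! ### Fractional orientations and their loads -/

section FractionalOrientations

variable {V : Type*} {G : SimpleGraph V}

/-- A fractional orientation of `G`: each edge `{u, v}` has a unit weight, of which it sends the
portion `t u v` to `v` and the portion `t v u` to `u`. -/
structure IsFracOrientation (G : SimpleGraph V) (t : V → V → ℝ) : Prop where
  nonneg : ∀ u v, 0 ≤ t u v
  add_swap : ∀ u v, G.Adj u v → t u v + t v u = 1
  eq_zero : ∀ u v, ¬ G.Adj u v → t u v = 0

open Classical in
/-- The fractional orientation sending an edge `{u, v}` entirely to `v` if `r u v`, entirely to `u`
if `r v u`, and in equal portions to both ends if neither holds. -/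
def halfOrientation (G : SimpleGraph V) (r : V → V → Prop) (u v : V) : ℝ :=
  if G.Adj u v then (if r u v then 1 else if r v u then 0 else 1 / 2) else 0

lemma isFracOrientation_halfOrientation {r : V → V → Prop} (hr : ∀ u v, r u v → ¬ r v u) :
    IsFracOrientation G (halfOrientation G r) where
  nonneg u v := by
    unfold halfOrientation
    split_ifs <;> norm_num
  add_swap u v h := by
    have := hr u v
    by_cases h1 : r u v <;> by_cases h2 : r v u <;>
      simp_all [halfOrientation, h.symm]
    norm_num
  eq_zero u v h := by simp [halfOrientation, h]

lemma halfOrientation_eq_zero {r : V → V → Prop} (hr : ∀ u v, r u v → ¬ r v u) {u v : V}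
    (h : r v u) : halfOrientation G r u v = 0 := by
  simp [halfOrientation, h, hr v u h]

lemma halfOrientation_pos {r : V → V → Prop} {u v : V} (huv : G.Adj u v) (h : ¬ r v u) :
    0 < halfOrientation G r u v := by
  unfold halfOrientation
  rw [if_pos huv, if_neg h]
  split_ifs <;> norm_num

lemma IsFracOrientation.induce {t : V → V → ℝ} (ht : IsFracOrientation G t) (s : Set V) :
    IsFracOrientation (G.induce s) (fun u v : s => t u v) where
  nonneg u v := ht.nonneg u v
  add_swap u v h := ht.add_swap u v h
  eq_zero u v h := ht.eq_zero u v h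

lemma IsFracOrientation.sum_sum_eq [Fintype V] {t : V → V → ℝ} (ht : IsFracOrientation G t) :
    ∑ u, ∑ v, t u v = G.edgeSet.ncard := by
  classical
  have h1 : ∑ u, ∑ v, (t u v + t v u) = 2 * (G.edgeSet.ncard : ℝ) := by
    have h2 : ∀ u, ∑ v, (t u v + t v u) = (G.degree u : ℝ) := by
      intro u
      rw [← G.card_neighborFinset_eq_degree, Finset.card_eq_sum_ones, Nat.cast_sum,
        G.neighborFinset_eq_filter, Finset.sum_filter]
      refine Finset.sum_congr rfl fun v _ => ?_
      split_ifs with h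
      · simpa using ht.add_swap u v h
      · rw [ht.eq_zero u v h, ht.eq_zero v u fun h' => h h'.symm, add_zero]
    simp_rw [h2]
    rw [← Nat.cast_sum, G.sum_degrees_eq_twice_card_edges, ← G.coe_edgeFinset,
      Set.ncard_coe_finset]
    push_cast
    ring
  simp_rw [Finset.sum_add_distrib] at h1
  rw [Finset.sum_comm (f := fun u v => t v u)] at h1
  linarith

lemma IsFracOrientation.sum_sum_mem_eq {t : V → V → ℝ} (ht : IsFracOrientation G t)
    (S : Finset V) :
    ∑ v ∈ S, ∑ u ∈ S, t u v = ((G.induce (S : Set V)).edgeSet.ncard : ℝ) := by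
  rw [← (ht.induce (S : Set V)).sum_sum_eq, Finset.sum_comm, ← Finset.sum_coe_sort S]
  exact Finset.sum_congr rfl fun u _ => (Finset.sum_coe_sort S fun v => t u v).symm

variable [Fintype V]

/-- Each vertex receives one unit, plus the portions sent to it by its edges. -/
def load (t : V → V → ℝ) (v : V) : ℝ := 1 + ∑ u, t u v

/-- Equality holds at `S` in the inequality `|S| + |E(G[S])| ≤ ∑ i ∈ S, x i`. -/
def IsTight (G : SimpleGraph V) (x : V → ℝ) (S : Finset V) : Prop :=
  ∑ i ∈ S, x i = (S.card : ℝ) + ((G.induce (S : Set V)).edgeSet.ncard : ℝ)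

variable [DecidableEq V]

lemma IsFracOrientation.sum_load {t : V → V → ℝ} (ht : IsFracOrientation G t) (S : Finset V) :
    ∑ v ∈ S, load t v = (S.card : ℝ) + ((G.induce (S : Set V)).edgeSet.ncard : ℝ)
      + ∑ v ∈ S, ∑ u ∈ Sᶜ, t u v := by
  rw [← ht.sum_sum_mem_eq S]
  simp_rw [load, ← Finset.sum_add_sum_compl S (fun u => t u _), Finset.sum_add_distrib]
  simp [add_assoc]

lemma IsFracOrientation.isTight_load_iff {t : V → V → ℝ} (ht : IsFracOrientation G t)
    {S : Finset V} : IsTight G (load t) S ↔ ∀ v ∈ S, ∀ u ∉ S, t u v = 0 := by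
  rw [IsTight, ht.sum_load, add_eq_left,
    Finset.sum_eq_zero_iff_of_nonneg fun v _ => Finset.sum_nonneg fun u _ => ht.nonneg u v]
  refine forall₂_congr fun v _ => ?_
  rw [Finset.sum_eq_zero_iff_of_nonneg fun u _ => ht.nonneg u v]
  simp

lemma IsFracOrientation.load_mem {t : V → V → ℝ} (ht : IsFracOrientation G t) :
    load t ∈ cleanZonotope G := by
  refine ⟨?_, fun S => ?_⟩
  · simp_rw [load, Finset.sum_add_distrib]
    rw [Finset.sum_comm, ht.sum_sum_eq]
    simp
  · rw [ht.sum_load]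
    exact le_add_of_nonneg_right
      (Finset.sum_nonneg fun v _ => Finset.sum_nonneg fun u _ => ht.nonneg u v)

omit [DecidableEq V] in
/-- A form of Abel summation. Raising the least value of `c` to the second least value `m'` changes
`∑ i, c i * y i` by a positive multiple of the sum of `y` over the set where `c` is least. -/
lemma sum_mul_nonneg_of_sublevel_sum_nonpos (y : V → ℝ) (hy : ∑ i, y i = 0) (c : V → ℝ)
    (h : ∀ r, ∑ i with c i ≤ r, y i ≤ 0) : 0 ≤ ∑ i, c i * y i := by
  classical
  induction hk : (Finset.univ.image c).card using Nat.strong_induction_on generalizing c with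
  | _ k ih =>
    by_cases hne : (Finset.univ.image c).Nonempty
    swap
    · rw [Finset.not_nonempty_iff_eq_empty, Finset.image_eq_empty] at hne
      simp [hne]
    set m := (Finset.univ.image c).min' hne
    have hmle : ∀ i, m ≤ c i := fun i => Finset.min'_le _ _ (by simp)
    obtain ⟨a, ha⟩ : ∃ a, c a = m := by simpa using (Finset.univ.image c).min'_mem hne
    by_cases hne' : ((Finset.univ.image c).erase m).Nonempty
    swap
    · have hconst : ∀ i, c i = m := by
        intro i
        by_contra hi
        exact hne' ⟨c i, Finset.mem_erase.2 ⟨hi, by simp⟩⟩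
      simp_rw [hconst]
      rw [← Finset.mul_sum, hy, mul_zero]
    set m' := ((Finset.univ.image c).erase m).min' hne' with hm'
    have hmem' := ((Finset.univ.image c).erase m).min'_mem hne'
    rw [← hm', Finset.mem_erase] at hmem'
    obtain ⟨hmm', hmem'⟩ := hmem'
    obtain ⟨b, -, hb⟩ := Finset.mem_image.1 hmem'
    have hlt : m < m' := lt_of_le_of_ne (hb ▸ hmle b) hmm'.symm
    have hle' : ∀ i, c i ≠ m → m' ≤ c i := fun i hi =>
      Finset.min'_le _ _ (Finset.mem_erase.2 ⟨hi, by simp⟩)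
    have hraise := ih ((Finset.univ.image fun i => max (c i) m').card) ?_
      (fun i => max (c i) m') ?_ rfl
    · have hsum : ∑ i, c i * y i =
          ∑ i, max (c i) m' * y i - (m' - m) * ∑ i with c i ≤ m, y i := by
        rw [Finset.sum_filter, Finset.mul_sum, ← Finset.sum_sub_distrib]
        refine Finset.sum_congr rfl fun i _ => ?_
        by_cases hi : c i = m
        · rw [hi, max_eq_right hlt.le, if_pos le_rfl]
          ring
        · rw [max_eq_left (hle' i hi), if_neg fun hle => hi (le_antisymm hle (hmle i))]
          ring
      rw [hsum]
      have := mul_nonpos_of_nonneg_of_nonpos (sub_nonneg.2 hlt.le) (h m)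
      linarith
    · rw [← hk]
      refine Finset.card_lt_card ((Finset.ssubset_iff_of_subset ?_).2 ⟨m, by simp [← ha], ?_⟩)
      · intro z hz
        obtain ⟨i, -, rfl⟩ := Finset.mem_image.1 hz
        rcases max_choice (c i) m' with h' | h' <;> simp only [h']
        · simp
        · exact hmem'
      · intro hz
        obtain ⟨i, -, hi⟩ := Finset.mem_image.1 hz
        have := le_max_right (c i) m'
        linarith
    · intro r
      by_cases hr : m' ≤ r
      · simpa [hr] using h r
      · simp [hr]

omit [DecidableEq V] in
/-- Over the polytope, `∑ i, c i * x i` is maximized by the load of the fractional orientation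
that sends each edge to its end with the larger value of `c`, since all sublevel sets of `c` are tight there. -/
lemma sum_mul_le_sum_mul_load {x : V → ℝ} (hx : x ∈ cleanZonotope G) (c : V → ℝ) :
    ∑ i, c i * x i ≤ ∑ i, c i * load (halfOrientation G fun u v => c u < c v) i := by
  classical
  have hasymm : ∀ u v, c u < c v → ¬ c v < c u := fun u v h => h.asymm
  have ht := isFracOrientation_halfOrientation (G := G) hasymm
  set w := load (halfOrientation G fun u v => c u < c v)
  have := sum_mul_nonneg_of_sublevel_sum_nonpos (w - x) ?_ c ?_
  · simpa [mul_sub, Finset.sum_sub_distrib] using this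
  · simp only [Pi.sub_apply, Finset.sum_sub_distrib]
    rw [ht.load_mem.1, hx.1, sub_self]
  · intro r
    have htight : IsTight G w ({i | c i ≤ r} : Finset V) := by
      refine ht.isTight_load_iff.2 fun v hv u hu => halfOrientation_eq_zero hasymm ?_
      simp only [Finset.mem_filter, Finset.mem_univ, true_and, not_le] at hv hu
      exact hv.trans_lt hu
    simp only [Pi.sub_apply, Finset.sum_sub_distrib]
    rw [htight]
    linarith [hx.2 ({i | c i ≤ r} : Finset V)]

end FractionalOrientations

/-! ### The graphical zonotope as the set of loads -/

section Zonotope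

variable {V : Type*} [Fintype V] [DecidableEq V] {G : SimpleGraph V}

omit [Fintype V] in
lemma mem_edgeSegment_iff {u v : V} {x : V → ℝ} : x ∈ edgeSegment s(u, v) ↔
    ∃ a : ℝ, |a| ≤ 1 ∧ x = a • (Pi.single u 1 - Pi.single v 1 : V → ℝ) := by
  change x ∈ segment ℝ (Pi.single u 1 - Pi.single v 1 : V → ℝ) _ ↔ _
  constructor
  · rintro ⟨a, b, ha, hb, hab, rfl⟩
    refine ⟨a - b, abs_le.2 ⟨by linarith, by linarith⟩, ?_⟩
    module
  · rintro ⟨a, ha, rfl⟩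
    rw [abs_le] at ha
    refine ⟨(1 + a) / 2, (1 - a) / 2, by linarith, by linarith, by ring, ?_⟩
    module

/-- A function on the edges, summed over ordered pairs of adjacent vertices, counts each edge
twice. -/
lemma sum_sum_adj_eq (G : SimpleGraph V) [DecidableRel G.Adj] (f : Sym2 V → ℝ) :
    ∑ u, ∑ v, (if G.Adj u v then f s(u, v) else 0) =
      2 * ∑ e ∈ G.edgeSet.toFinite.toFinset, f e := by
  have hfin : G.edgeSet.toFinite.toFinset = G.edgeFinset := by
    ext e
    simp
  have h1 : ∑ d : G.Dart, f d.edge = 2 * ∑ e ∈ G.edgeFinset, f e := by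
    rw [← Finset.sum_fiberwise_of_maps_to (s := Finset.univ) (t := G.edgeFinset)
      (g := fun d : G.Dart => d.edge) (fun d _ => SimpleGraph.mem_edgeFinset.2 d.edge_mem),
      Finset.mul_sum]
    refine Finset.sum_congr rfl fun e he => ?_
    rw [Finset.sum_congr rfl fun d hd => by rw [(Finset.mem_filter.1 hd).2],
      Finset.sum_const, G.dart_edge_fiber_card e (SimpleGraph.mem_edgeFinset.1 he)]
    simp
  rw [hfin, ← h1, ← Finset.sum_product', ← Finset.sum_filter]
  symm
  refine Finset.sum_bij (fun d _ => d.toProd) (fun d _ => by simp)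
    (fun d _ d' _ h => SimpleGraph.Dart.ext _ _ h) (fun p hp => ?_) (fun d _ => rfl)
  exact ⟨⟨p, by simpa using hp⟩, by simp, rfl⟩

/-- The vector of the edge `{u, v}` in the graphical zonotope that corresponds to the fractional
orientation `t`. -/
def edgeVector (t : V → V → ℝ) : Sym2 V → V → ℝ :=
  Sym2.lift ⟨fun u v => (t v u - t u v) • (Pi.single u 1 - Pi.single v 1 : V → ℝ),
    fun u v => by module⟩

omit [Fintype V] in
lemma edgeVector_mk (t : V → V → ℝ) (u v : V) :
    edgeVector t s(u, v) = (t v u - t u v) • (Pi.single u 1 - Pi.single v 1 : V → ℝ) := rfl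

lemma IsFracOrientation.load_eq {t : V → V → ℝ} (ht : IsFracOrientation G t) :
    load t = (1 / 2 : ℝ) • (∑ e ∈ G.edgeSet.toFinite.toFinset, edgeVector t e)
      + ((1 / 2 : ℝ) • degreeVector G + 1) := by
  classical
  ext w
  have h1 := sum_sum_adj_eq G fun e => edgeVector t e w
  have h2 : ∀ u v, (if G.Adj u v then edgeVector t s(u, v) w else 0) =
      (t v u - t u v) * (if w = u then 1 else 0) - (t v u - t u v) * (if w = v then 1 else 0) := by
    intro u v
    split_ifs with h <;>
      simp_all [edgeVector_mk, Pi.single_apply, ht.eq_zero u v, ht.eq_zero v u, G.adj_comm v u]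
  simp_rw [h2, Finset.sum_sub_distrib] at h1
  rw [Finset.sum_comm (f := fun u v => (t v u - t u v) * (if w = u then (1 : ℝ) else 0))] at h1
  simp only [mul_ite, mul_one, mul_zero, Finset.sum_ite_eq, Finset.mem_univ, if_true,
    Finset.sum_sub_distrib] at h1
  have h3 : degreeVector G w = ∑ u, (t u w + t w u) := by
    rw [degreeVector, ← G.coe_neighborFinset, Set.ncard_coe_finset, Finset.card_eq_sum_ones,
      Nat.cast_sum, G.neighborFinset_eq_filter, Finset.sum_filter]
    refine Finset.sum_congr rfl fun u _ => ?_
    split_ifs with h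
    · simpa using (ht.add_swap u w h.symm).symm
    · simp [ht.eq_zero w u h, ht.eq_zero u w fun h' => h h'.symm]
  rw [Finset.sum_add_distrib] at h3
  simp only [load, Pi.add_apply, Pi.smul_apply, Finset.sum_apply, smul_eq_mul, Pi.one_apply, h3]
  linarith

/-- Translating half the graphical zonotope by `d / 2 + 1` gives the set of loads of fractional
orientations: a point of the segment of an edge records how the edge splits its weight. -/
lemma mem_translate_zonotope_iff {x : V → ℝ} :
    x ∈ (1 / 2 : ℝ) • graphicalZonotope G + {(1 / 2 : ℝ) • degreeVector G + 1} ↔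
      ∃ t, IsFracOrientation G t ∧ load t = x := by
  classical
  rw [Set.add_singleton, graphicalZonotope]
  constructor
  · rintro ⟨-, ⟨z, hz, rfl⟩, rfl⟩
    obtain ⟨g, hg, rfl⟩ := (Set.mem_finsetSum _ _ _).1 hz
    have hg' : ∀ u v, G.Adj u v → ∃ a : ℝ, |a| ≤ 1 ∧
        g s(u, v) = a • (Pi.single u 1 - Pi.single v 1 : V → ℝ) := fun u v h =>
      mem_edgeSegment_iff.1 (hg (by simpa using h))
    -- The vector `g s(u, v)` is `a • (e_u - e_v)` with `|a| ≤ 1`; the edge sends `(1 + a) / 2` to `u`.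
    set t : V → V → ℝ := fun u v => if G.Adj u v then (1 + g s(u, v) v) / 2 else 0 with htdef
    have hval : ∀ u v, G.Adj u v → ∃ a : ℝ, |a| ≤ 1 ∧ t v u = (1 + a) / 2 ∧ t u v = (1 - a) / 2 ∧
        g s(u, v) = a • (Pi.single u 1 - Pi.single v 1 : V → ℝ) := by
      intro u v h
      obtain ⟨a, ha, hga⟩ := hg' u v h
      refine ⟨a, ha, ?_, ?_, hga⟩
      · simp [htdef, h.symm, Sym2.eq_swap (a := v), hga, h.ne]
      · simp [htdef, h, hga, h.ne', sub_eq_add_neg]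
    have ht : IsFracOrientation G t := by
      refine ⟨fun u v => ?_, fun u v h => ?_, fun u v h => if_neg h⟩
      · by_cases h : G.Adj u v
        · obtain ⟨a, ha, -, h2, -⟩ := hval u v h
          rw [h2]
          linarith [(abs_le.1 ha).2]
        · exact (if_neg h).ge
      · obtain ⟨a, -, h1, h2, -⟩ := hval u v h
        rw [h1, h2]
        ring
    refine ⟨t, ht, ?_⟩
    rw [ht.load_eq]
    refine congrArg₂ (· + ·) (congrArg _ (Finset.sum_congr rfl fun e he => ?_)) rfl
    induction e with
    | _ u v =>
      obtain ⟨a, -, h1, h2, h3⟩ := hval u v (by simpa using he)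
      rw [edgeVector_mk, h1, h2, h3]
      congr 1
      ring
  · rintro ⟨t, ht, rfl⟩
    refine ⟨_, ⟨_, (Set.mem_finsetSum _ _ _).2 ⟨edgeVector t, fun {e} he => ?_, rfl⟩, rfl⟩,
      ht.load_eq.symm⟩
    induction e with
    | _ u v =>
      have h : G.Adj u v := by simpa using he
      refine mem_edgeSegment_iff.2 ⟨t v u - t u v, abs_le.2 ⟨?_, ?_⟩, rfl⟩ <;>
        linarith [ht.nonneg u v, ht.nonneg v u, ht.add_swap u v h]

lemma isPolytope_translate_zonotope (G : SimpleGraph V) : IsPolytope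
    ((1 / 2 : ℝ) • graphicalZonotope G + {(1 / 2 : ℝ) • degreeVector G + 1} : Set (V → ℝ)) := by
  refine ((IsPolytope.sum _ fun e _ => ?_).smul _).add (isPolytope_singleton _)
  induction e with
  | _ u v => exact isPolytope_segment _ _

lemma strongDual_apply_eq_sum (l : StrongDual ℝ (V → ℝ)) (x : V → ℝ) :
    l x = ∑ i, l (Pi.single i 1) * x i := by
  conv_lhs => rw [pi_eq_sum_univ' x]
  simp [mul_comm]

/-- Every point of the polytope is the load of a fractional orientation. Otherwise a linear
functional would separate it from the polytope of all loads, contradicting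
`sum_mul_le_sum_mul_load`. -/
theorem exists_load_eq_of_mem {x : V → ℝ} (hx : x ∈ cleanZonotope G) :
    ∃ t, IsFracOrientation G t ∧ load t = x := by
  rw [← mem_translate_zonotope_iff]
  by_contra hmem
  have hP := isPolytope_translate_zonotope G
  obtain ⟨l, b, hl, hb⟩ :=
    geometric_hahn_banach_closed_point hP.convex hP.isCompact.isClosed hmem
  have h := sum_mul_le_sum_mul_load hx fun i => l (Pi.single i 1)
  rw [← strongDual_apply_eq_sum, ← strongDual_apply_eq_sum] at h
  have hload := hl (load (halfOrientation G fun u v => l (Pi.single u 1) < l (Pi.single v 1)))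
    (mem_translate_zonotope_iff.2
      ⟨_, isFracOrientation_halfOrientation fun _ _ => lt_asymm, rfl⟩)
  exact absurd (h.trans_lt hload) hb.not_gt

theorem cleanZonotope_eq (G : SimpleGraph V) : cleanZonotope G =
    (1 / 2 : ℝ) • graphicalZonotope G + {(1 / 2 : ℝ) • degreeVector G + 1} := by
  ext x
  rw [mem_translate_zonotope_iff]
  refine ⟨exists_load_eq_of_mem, ?_⟩
  rintro ⟨t, ht, rfl⟩
  exact ht.load_mem

/-- The polytope, which is defined by linear inequalities, is the convex hull of a finite set because
it is a translate of a scaled zonotope. -/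
theorem isPolytope_cleanZonotope (G : SimpleGraph V) : IsPolytope (cleanZonotope G) := by
  rw [cleanZonotope_eq]
  exact isPolytope_translate_zonotope G

end Zonotope

/-! ### Order-ideal lattices of partial acyclic orientations -/

section PartialAcyclicOrientations

variable {V : Type*} [Fintype V] [DecidableEq V] {G : SimpleGraph V}

omit [Fintype V] [DecidableEq V] in
/-- A relation that holds along edges inside a connected induced subgraph, and is reflexive and
transitive, holds between any two of its vertices. -/
lemma SimpleGraph.rel_of_induce_connected {σ : Set V} (hσ : (G.induce σ).Connected)
    {r : V → V → Prop} (hrefl : ∀ u, r u u) (htrans : ∀ u v w, r u v → r v w → r u w)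
    (hadj : ∀ u ∈ σ, ∀ v ∈ σ, G.Adj u v → r u v) {u v : V} (hu : u ∈ σ) (hv : v ∈ σ) :
    r u v := by
  have key : ∀ a b : σ, (G.induce σ).Walk a b → r a b := by
    intro a b w
    induction w with
    | nil => exact hrefl _
    | @cons a b c hab _ ih => exact htrans _ _ _ (hadj a a.2 b b.2 hab) ih
  obtain ⟨w⟩ := hσ.preconnected ⟨u, hu⟩ ⟨v, hv⟩
  exact key _ _ w

namespace OrientedPartition

variable {D : OrientedPartition G} {O : GraphOrientation G}

/-- The part containing the vertex `u`. -/
def partOf (D : OrientedPartition G) (u : V) : {σ : Finset V // σ ∈ D.partition.parts} :=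
  ⟨D.partition.part u, D.partition.part_mem.2 (Finset.mem_univ u)⟩

lemma mem_partOf (D : OrientedPartition G) (u : V) : u ∈ (D.partOf u).1 :=
  D.partition.mem_part (Finset.mem_univ u)

lemma partOf_eq {σ : {σ : Finset V // σ ∈ D.partition.parts}} {u : V} (hu : u ∈ σ.1) :
    D.partOf u = σ :=
  Subtype.ext (D.partition.part_eq_of_mem σ.2 hu)

lemma Induces.dir_iff (h : D.Induces O) {u v : V} (huv : G.Adj u v) :
    O.dir u v ↔ D.orient.dir (D.partOf u) (D.partOf v) := by
  refine ⟨fun hd => ?_, (h u v huv _ _ (D.mem_partOf u) (D.mem_partOf v)).2⟩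
  have hne : D.partOf u ≠ D.partOf v := fun e =>
    ((h u v huv _ _ (D.mem_partOf u) (D.mem_partOf v)).1 e).1 hd
  rcases D.acyclic.total _ _ ⟨hne, u, D.mem_partOf u, v, D.mem_partOf v, huv⟩ with h1 | h1
  · exact h1
  · exact absurd ((h v u huv.symm _ _ (D.mem_partOf v) (D.mem_partOf u)).2 h1) (O.asymm _ _ hd)

lemma Induces.partOf_eq_or_dir (h : D.Induces O) {u v : V} (huv : G.Adj u v) :
    D.partOf u = D.partOf v ∨ O.dir u v ∨ O.dir v u := by
  by_contra! hcon
  exact hcon.1 (Subtype.ext ((h.undirected_iff huv).1 hcon.2))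

lemma Induces.not_dir_of_partOf_eq (h : D.Induces O) {u v : V} (huv : D.partOf u = D.partOf v) :
    ¬ O.dir u v := fun hd =>
  ((h.undirected_iff (O.adj_of_dir _ _ hd)).2 (congrArg Subtype.val huv)).1 hd

/-- The sets in the order-ideal lattice are those that all boundary edges leave. -/
lemma Induces.mem_idealSets_iff (h : D.Induces O) {S : Set V} :
    S ∈ D.idealSets ↔ ∀ u v, G.Adj u v → u ∈ S → v ∉ S → O.dir u v := by
  constructor
  · rintro ⟨I, hI, rfl⟩ u v huv hu hv
    simp only [Set.mem_iUnion, Finset.mem_coe, exists_prop, not_exists, not_and] at hu hv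
    obtain ⟨σ, hσ, huσ⟩ := hu
    rcases h.partOf_eq_or_dir huv with h1 | h1 | h1
    · rw [partOf_eq huσ] at h1
      exact absurd (D.mem_partOf v) (hv _ (h1 ▸ hσ))
    · exact h1
    · rw [h.dir_iff huv.symm, partOf_eq huσ] at h1
      exact absurd (D.mem_partOf v) (hv _ (hI _ _ (Relation.ReflTransGen.single h1) hσ))
  · intro hS
    have hpart : ∀ u v, D.partOf u = D.partOf v → u ∈ S → v ∈ S := by
      intro u v huv
      refine SimpleGraph.rel_of_induce_connected (r := fun a b => a ∈ S → b ∈ S)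
        (D.connected _ (D.partOf v).2) (fun _ => id) (fun _ _ _ h1 h2 => h2 ∘ h1) ?_
        (huv ▸ D.mem_partOf u) (D.mem_partOf v)
      intro a ha b hb hab haS
      by_contra hbS
      exact h.not_dir_of_partOf_eq ((partOf_eq ha).trans (partOf_eq hb).symm) (hS a b hab haS hbS)
    refine ⟨{σ | (σ.1 : Set V) ⊆ S}, fun σ ρ hσρ => ?_, ?_⟩
    · induction hσρ using Relation.ReflTransGen.head_induction_on with
      | refl => exact id
      | @head σ τ hd _ ih =>
        intro hρ a ha
        obtain ⟨-, u, hu, v, hv, huv⟩ := D.orient.adj_of_dir _ _ hd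
        have huS : u ∈ S := by
          by_contra huS
          refine O.asymm u v ?_ (hS v u huv.symm (ih hρ hv) huS)
          rwa [h.dir_iff huv, partOf_eq hu, partOf_eq hv]
        exact hpart u a ((partOf_eq hu).trans (partOf_eq ha).symm) huS
    · ext u
      simp only [Set.mem_ofPred_eq, Set.mem_iUnion, exists_prop]
      constructor
      · intro hu
        exact ⟨D.partOf u, fun v hv => hpart u v (partOf_eq hv).symm hu, D.mem_partOf u⟩
      · rintro ⟨σ, hσ, huσ⟩
        exact hσ huσ

/-- Directed edges are those that leave some set of the order-ideal lattice: the principal ideal of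
the part of the tail does not contain the head, by acyclicity. -/
lemma Induces.dir_iff_exists_idealSets (h : D.Induces O) {u v : V} :
    O.dir u v ↔ G.Adj u v ∧ ∃ S ∈ D.idealSets, u ∈ S ∧ v ∉ S := by
  constructor
  · intro hd
    have huv := O.adj_of_dir _ _ hd
    refine ⟨huv, {w | Relation.ReflTransGen D.orient.dir (D.partOf w) (D.partOf u)}, ?_,
      Relation.ReflTransGen.refl, fun hv => ?_⟩
    · rw [h.mem_idealSets_iff]
      intro a b hab ha hb
      rcases h.partOf_eq_or_dir hab with h1 | h1 | h1
      · exact absurd (show Relation.ReflTransGen _ (D.partOf b) _ from h1 ▸ ha) hb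
      · exact h1
      · exact absurd (Relation.ReflTransGen.head ((h.dir_iff hab.symm).1 h1) ha) hb
    · exact D.acyclic.noCycle _ (Relation.TransGen.head' ((h.dir_iff huv).1 hd) hv)
  · rintro ⟨huv, S, hS, hu, hv⟩
    exact h.mem_idealSets_iff.1 hS u v huv hu hv

/-- The number of parts strictly below the part of a vertex increases along directed edges. -/
lemma Induces.exists_height (h : D.Induces O) :
    ∃ c : V → ℝ, ∀ u v, G.Adj u v → (O.dir u v ↔ c u < c v) := by
  classical
  let f : V → ℝ := fun u =>
    (Finset.univ.filter fun σ => Relation.TransGen D.orient.dir σ (D.partOf u)).card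
  have hlt : ∀ u v, O.dir u v → f u < f v := by
    intro u v hd
    have hd' := (h.dir_iff (O.adj_of_dir _ _ hd)).1 hd
    refine Nat.cast_lt.2 (Finset.card_lt_card
      ((Finset.ssubset_iff_of_subset fun σ hσ => ?_).2 ⟨D.partOf u, ?_, ?_⟩))
    · simp only [Finset.mem_filter, Finset.mem_univ, true_and] at hσ ⊢
      exact hσ.tail hd'
    · simpa using Relation.TransGen.single hd'
    · simpa using D.acyclic.noCycle _
  refine ⟨f, fun u v huv => ⟨hlt u v, fun hf => ?_⟩⟩
  rcases h.partOf_eq_or_dir huv with h1 | h1 | h1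
  · exact absurd hf (by simp [f, h1])
  · exact h1
  · exact absurd hf (hlt v u h1).not_gt

end OrientedPartition

namespace PAO

lemma mem_idealLattice_iff {O : PAO G} {S : Set V} :
    S ∈ O.idealLattice ↔ ∀ u v, G.Adj u v → u ∈ S → v ∉ S → O.1.dir u v :=
  O.oriented_induces.mem_idealSets_iff

lemma dir_iff {O : PAO G} {u v : V} :
    O.1.dir u v ↔ G.Adj u v ∧ ∃ S ∈ O.idealLattice, u ∈ S ∧ v ∉ S :=
  O.oriented_induces.dir_iff_exists_idealSets

lemma idealLattice_injective : Function.Injective (idealLattice : PAO G → Set (Set V)) := by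
  intro O O' h
  refine Subtype.ext (GraphOrientation.ext ?_)
  funext u v
  rw [eq_iff_iff, dir_iff, dir_iff, h]

/-- Every real function on the vertices orients the edges, from smaller to larger values, to a
p.a.o. The parts are the components of the graph of the edges on which the function is constant. -/
theorem exists_dir_iff_lt (G : SimpleGraph V) (c : V → ℝ) :
    ∃ O : PAO G, ∀ u v, G.Adj u v → (O.1.dir u v ↔ c u < c v) := by
  classical
  let H : SimpleGraph V :=
    { Adj := fun u v => G.Adj u v ∧ c u = c v
      symm := ⟨fun u v h => ⟨h.1.symm, h.2.symm⟩⟩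
      loopless := ⟨fun u h => h.1.ne rfl⟩ }
  let P : Finpartition (Finset.univ : Finset V) := Finpartition.ofSetoid H.reachableSetoid
  have hreach : ∀ σ ∈ P.parts, ∀ u ∈ σ, ∀ v, v ∈ σ ↔ H.Reachable u v := by
    intro σ hσ u hu v
    rw [← P.part_eq_of_mem hσ hu]
    exact Finpartition.mem_part_ofSetoid_iff_rel
  have hconst : ∀ σ ∈ P.parts, ∀ u ∈ σ, ∀ v ∈ σ, c u = c v := by
    intro σ hσ u hu v hv
    obtain ⟨w⟩ := (hreach σ hσ u hu v).1 hv
    clear hu hv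
    induction w with
    | nil => rfl
    | cons h _ ih => exact h.2.trans ih
  have hconn : IsConnectedPartition G P := by
    intro σ hσ
    have key : ∀ u v, H.Walk u v → ∀ (hu : u ∈ σ) (hv : v ∈ σ),
        (G.induce (σ : Set V)).Reachable ⟨u, hu⟩ ⟨v, hv⟩ := by
      intro u v w
      induction w with
      | nil => exact fun _ _ => SimpleGraph.Reachable.refl _
      | @cons u v x h _ ih =>
        intro hu hx
        have hv : v ∈ σ := (hreach σ hσ u hu v).2 h.reachable
        have hadj : (G.induce (σ : Set V)).Adj ⟨u, hu⟩ ⟨v, hv⟩ := h.1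
        exact hadj.reachable.trans (ih hv hx)
    obtain ⟨a, ha⟩ := P.nonempty_of_mem_parts hσ
    have : Nonempty (σ : Set V) := ⟨⟨a, ha⟩⟩
    refine ⟨fun u v => ?_⟩
    obtain ⟨w⟩ := (hreach σ hσ u.1 u.2 v.1).1 v.2
    exact key _ _ w u.2 v.2
  -- The constant value of `c` on a part; it increases along the orientation of the partition graph.
  let val : {σ : Finset V // σ ∈ P.parts} → ℝ := fun σ => c (P.nonempty_of_mem_parts σ.2).choose
  have hval : ∀ (σ : {σ : Finset V // σ ∈ P.parts}), ∀ u ∈ σ.1, val σ = c u := fun σ u hu =>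
    hconst _ σ.2 _ (P.nonempty_of_mem_parts σ.2).choose_spec u hu
  let Q : GraphOrientation (partitionGraph G P) :=
    { dir := fun σ ρ => (partitionGraph G P).Adj σ ρ ∧ val σ < val ρ
      adj_of_dir := fun _ _ h => h.1
      asymm := fun _ _ h h' => lt_asymm h.2 h'.2 }
  have hQ : Q.IsAcyclic := by
    constructor
    · intro σ ρ hadj
      obtain ⟨hne, u, hu, v, hv, huv⟩ := id hadj
      have hcne : val σ ≠ val ρ := by
        intro heq
        rw [hval σ u hu, hval ρ v hv] at heq
        have hHuv : H.Adj u v := ⟨huv, heq⟩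
        have hvσ : v ∈ σ.1 := (hreach _ σ.2 u hu v).2 hHuv.reachable
        exact hne (Subtype.ext (P.eq_of_mem_parts σ.2 ρ.2 hvσ hv))
      rcases hcne.lt_or_gt with h | h
      · exact Or.inl ⟨hadj, h⟩
      · exact Or.inr ⟨hadj.symm, h⟩
    · intro σ hσ
      have key : ∀ ρ, Relation.TransGen Q.dir σ ρ → val σ < val ρ := by
        intro ρ hρ
        induction hρ with
        | single h => exact h.2
        | tail _ h ih => exact ih.trans h.2
      exact lt_irrefl _ (key σ hσ)
  let O : GraphOrientation G :=
    { dir := fun u v => G.Adj u v ∧ c u < c v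
      adj_of_dir := fun _ _ h => h.1
      asymm := fun _ _ h h' => lt_asymm h.2 h'.2 }
  refine ⟨⟨O, ⟨P, hconn, Q, hQ⟩, ?_⟩, fun u v huv => ⟨fun h => h.2, fun h => ⟨huv, h⟩⟩⟩
  intro u v huv σ ρ hu hv
  refine ⟨?_, fun hd => ⟨huv, ?_⟩⟩
  · rintro rfl
    have := hconst _ σ.2 u hu v hv
    exact ⟨fun h => h.2.ne this, fun h => h.2.ne' this⟩
  · rw [← hval σ u hu, ← hval ρ v hv]
    exact hd.2

end PAO

end PartialAcyclicOrientations

/-! ### Faces of the polytope and partial acyclic orientations -/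

section Faces

variable {V : Type*} [Fintype V] [DecidableEq V] {G : SimpleGraph V}

omit [DecidableEq V] in
/-- Each edge contributes to the difference of the values of `c` at two loads separately; it is
counted twice, once for each order of its ends. -/
lemma sum_mul_load_sub_sum_mul_load {s t : V → V → ℝ} (hs : IsFracOrientation G s)
    (ht : IsFracOrientation G t) (c : V → ℝ) :
    2 * (∑ i, c i * load s i - ∑ i, c i * load t i) =
      ∑ u, ∑ v, (s u v - t u v) * (c v - c u) := by
  have h1 : ∑ i, c i * load s i - ∑ i, c i * load t i = ∑ u, ∑ v, (s u v - t u v) * c v := by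
    rw [Finset.sum_comm, ← Finset.sum_sub_distrib]
    refine Finset.sum_congr rfl fun v _ => ?_
    rw [← Finset.sum_mul, Finset.sum_sub_distrib, load, load]
    ring
  have h2 : ∑ u, ∑ v, (s u v - t u v) * c v = ∑ u, ∑ v, (t u v - s u v) * c u := by
    rw [Finset.sum_comm]
    refine Finset.sum_congr rfl fun u _ => Finset.sum_congr rfl fun v _ => ?_
    by_cases h : G.Adj u v
    · have h3 : s v u - t v u = t u v - s u v := by
        linarith [hs.add_swap u v h, ht.add_swap u v h]
      rw [h3]
    · have h' : ¬ G.Adj v u := fun h' => h h'.symm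
      simp [hs.eq_zero _ _ h, ht.eq_zero _ _ h, hs.eq_zero _ _ h', ht.eq_zero _ _ h']
  have h3 : ∑ u, ∑ v, (s u v - t u v) * (c v - c u) =
      ∑ u, ∑ v, (s u v - t u v) * c v + ∑ u, ∑ v, (t u v - s u v) * c u := by
    simp_rw [← Finset.sum_add_distrib]
    refine Finset.sum_congr rfl fun u _ => Finset.sum_congr rfl fun v _ => ?_
    ring
  rw [h3, ← h2, h1, two_mul]

/-- A load maximizes a linear functional over the polytope if and only if every edge on whose ends
the functional takes different values is directed to the end with the larger value. -/
lemma load_mem_toExposed_iff {t : V → V → ℝ} (ht : IsFracOrientation G t)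
    (l : StrongDual ℝ (V → ℝ)) : load t ∈ l.toExposed (cleanZonotope G) ↔
      ∀ u v, l (Pi.single u 1) < l (Pi.single v 1) → t v u = 0 := by
  set c : V → ℝ := fun i => l (Pi.single i 1)
  have hl : ∀ x, l x = ∑ i, c i * x i := strongDual_apply_eq_sum l
  have hasymm : ∀ u v, c u < c v → ¬ c v < c u := fun _ _ => lt_asymm
  set s := halfOrientation G fun u v => c u < c v
  have hs : IsFracOrientation G s := isFracOrientation_halfOrientation hasymm
  have hterm : ∀ u v, 0 ≤ (s u v - t u v) * (c v - c u) ∧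
      ((s u v - t u v) * (c v - c u) = 0 ↔ (c u < c v → t v u = 0) ∧ (c v < c u → t u v = 0)) := by
    intro u v
    by_cases h : G.Adj u v
    · have hadd := ht.add_swap u v h
      have hsadd := hs.add_swap u v h
      rcases lt_trichotomy (c u) (c v) with hlt | heq | hlt
      · have h0 : s v u = 0 := halfOrientation_eq_zero hasymm hlt
        have h1 : s u v - t u v = t v u := by linarith
        rw [h1]
        refine ⟨mul_nonneg (ht.nonneg v u) (sub_nonneg.2 hlt.le), ?_⟩
        simp [hlt, hlt.not_gt, (sub_pos.2 hlt).ne']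
      · simp [heq]
      · have h0 : s u v = 0 := halfOrientation_eq_zero hasymm hlt
        rw [h0, zero_sub, neg_mul, ← mul_neg, neg_sub]
        refine ⟨mul_nonneg (ht.nonneg u v) (sub_nonneg.2 hlt.le), ?_⟩
        simp [hlt, hlt.not_gt, (sub_pos.2 hlt).ne']
    · have h' : ¬ G.Adj v u := fun h' => h h'.symm
      simp [hs.eq_zero u v h, ht.eq_zero u v h, ht.eq_zero v u h']
  have hkey := sum_mul_load_sub_sum_mul_load hs ht c
  have hmem : load t ∈ l.toExposed (cleanZonotope G) ↔
      ∑ u, ∑ v, (s u v - t u v) * (c v - c u) = 0 := by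
    rw [← hkey]
    constructor
    · rintro ⟨-, hmax⟩
      have h1 := hmax _ hs.load_mem
      have h2 := sum_mul_le_sum_mul_load ht.load_mem c
      rw [hl, hl] at h1
      linarith
    · intro h
      refine ⟨ht.load_mem, fun y hy => ?_⟩
      have h2 := sum_mul_le_sum_mul_load hy c
      rw [hl, hl]
      linarith
  rw [hmem, Finset.sum_eq_zero_iff_of_nonneg fun u _ =>
    Finset.sum_nonneg fun v _ => (hterm u v).1]
  simp only [Finset.mem_univ, true_implies,
    Finset.sum_eq_zero_iff_of_nonneg fun v _ => (hterm _ v).1, (hterm _ _).2]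
  exact ⟨fun h u v => (h u v).1, fun h u v => ⟨h u v, h v u⟩⟩

namespace PAO

/-- The face of the polytope that belongs to a p.a.o.: the points at which all sets of the
order-ideal lattice are tight. -/
def face (O : PAO G) : Set (V → ℝ) :=
  {x ∈ cleanZonotope G | ∀ S : Finset V, (S : Set V) ∈ O.idealLattice → IsTight G x S}

lemma load_mem_face_iff {O : PAO G} {t : V → V → ℝ} (ht : IsFracOrientation G t) :
    load t ∈ O.face ↔ ∀ u v, O.1.dir u v → t v u = 0 := by
  classical
  constructor
  · rintro ⟨-, h⟩ u v hd
    obtain ⟨-, S, hS, hu, hv⟩ := dir_iff.1 hd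
    have htight := ht.isTight_load_iff.1 (h S.toFinset (by simpa using hS))
    exact htight u (by simpa using hu) v (by simpa using hv)
  · refine fun h => ⟨ht.load_mem, fun S hS => ht.isTight_load_iff.2 fun v hv u hu => ?_⟩
    by_cases hadj : G.Adj u v
    · exact h v u (mem_idealLattice_iff.1 hS v u hadj.symm hv hu)
    · exact ht.eq_zero u v hadj

lemma face_eq_toExposed {O : PAO G} {l : StrongDual ℝ (V → ℝ)}
    (h : ∀ u v, G.Adj u v → (O.1.dir u v ↔ l (Pi.single u 1) < l (Pi.single v 1))) :
    O.face = l.toExposed (cleanZonotope G) := by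
  have key : ∀ t, IsFracOrientation G t →
      (load t ∈ O.face ↔ load t ∈ l.toExposed (cleanZonotope G)) := by
    intro t ht
    rw [load_mem_face_iff ht, load_mem_toExposed_iff ht]
    refine forall₂_congr fun u v => ?_
    by_cases hadj : G.Adj u v
    · rw [h u v hadj]
    · simp [ht.eq_zero v u fun h' => hadj h'.symm]
  ext x
  constructor
  · intro hx
    obtain ⟨t, ht, rfl⟩ := exists_load_eq_of_mem hx.1
    exact (key t ht).1 hx
  · intro hx
    obtain ⟨t, ht, rfl⟩ := exists_load_eq_of_mem hx.1
    exact (key t ht).2 hx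

/-- The load of the fractional orientation that splits undirected edges evenly. -/
def center (O : PAO G) : V → ℝ := load (halfOrientation G O.1.dir)

lemma center_mem_face (O : PAO G) : O.center ∈ O.face :=
  (load_mem_face_iff (isFracOrientation_halfOrientation O.1.asymm)).2
    fun _ _ hd => halfOrientation_eq_zero O.1.asymm hd

/-- No sets other than those of the order-ideal lattice are tight at the center. -/
lemma isTight_center_iff {O : PAO G} {S : Finset V} :
    IsTight G O.center S ↔ (S : Set V) ∈ O.idealLattice := by
  refine ⟨fun h => mem_idealLattice_iff.2 fun u v huv hu hv => ?_, O.center_mem_face.2 S⟩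
  by_contra hd
  exact (halfOrientation_pos huv.symm hd).ne'
    ((isFracOrientation_halfOrientation O.1.asymm).isTight_load_iff.1 h u hu v hv)

lemma face_subset_face_iff {O O' : PAO G} : O.face ⊆ O'.face ↔ O ≤ O' := by
  classical
  constructor
  · -- The center of `O` lies in the larger face, so all sets in the lattice of `O'` are tight there.
    intro h S hS
    have := (h O.center_mem_face).2 S.toFinset (by simpa using hS)
    simpa using isTight_center_iff.1 this
  · exact fun h x hx => ⟨hx.1, fun S hS => hx.2 S (h hS)⟩

lemma face_injective : Function.Injective (face : PAO G → Set (V → ℝ)) := fun _ _ h =>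
  idealLattice_injective (Set.Subset.antisymm (face_subset_face_iff.1 h.ge)
    (face_subset_face_iff.1 h.le))

lemma face_mem_faces (O : PAO G) : O.face ∈ faces (cleanZonotope G) := by
  obtain ⟨c, hc⟩ := O.oriented_induces.exists_height
  refine ⟨⟨_, O.center_mem_face⟩, ?_⟩
  rw [face_eq_toExposed (l := ∑ i, c i • ContinuousLinearMap.proj i)]
  · exact ContinuousLinearMap.toExposed.isExposed
  · intro u v huv
    simpa [Pi.single_apply] using hc u v huv

lemma exists_face_eq {F : Set (V → ℝ)} (hF : F ∈ faces (cleanZonotope G)) :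
    ∃ O : PAO G, O.face = F := by
  obtain ⟨l, rfl⟩ := hF.2 hF.1
  obtain ⟨O, hO⟩ := exists_dir_iff_lt G fun i => l (Pi.single i 1)
  exact ⟨O, face_eq_toExposed hO⟩

/-- P.a.o.'s correspond to the non-empty faces of the polytope. -/
def faceEquiv (G : SimpleGraph V) : PAO G ≃ faces (cleanZonotope G) :=
  Equiv.ofBijective (fun O => ⟨O.face, O.face_mem_faces⟩)
    ⟨fun _ _ h => face_injective (congrArg Subtype.val h), fun F => by
      obtain ⟨O, hO⟩ := exists_face_eq F.2
      exact ⟨O, Subtype.ext hO⟩⟩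

end PAO

end Faces

/-! ### Dimensions of the faces -/

section Dimension

variable {V : Type*} [Fintype V] [DecidableEq V] {G : SimpleGraph V}

namespace OrientedPartition

/-- The linear map sending a vector to its sums over the parts of the connected partition. -/
def partSum (D : OrientedPartition G) :
    (V → ℝ) →ₗ[ℝ] ({σ : Finset V // σ ∈ D.partition.parts} → ℝ) :=
  LinearMap.pi fun σ => ∑ i ∈ σ.1, LinearMap.proj i

lemma partSum_apply (D : OrientedPartition G) (y : V → ℝ)
    (σ : {σ : Finset V // σ ∈ D.partition.parts}) : D.partSum y σ = ∑ i ∈ σ.1, y i := by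
  simp [partSum]

/-- A chosen vertex of each part. -/
def rep (D : OrientedPartition G) (σ : {σ : Finset V // σ ∈ D.partition.parts}) : V :=
  (D.partition.nonempty_of_mem_parts σ.2).choose

lemma rep_mem (D : OrientedPartition G) (σ : {σ : Finset V // σ ∈ D.partition.parts}) :
    D.rep σ ∈ σ.1 :=
  (D.partition.nonempty_of_mem_parts σ.2).choose_spec

lemma mem_iff_partOf_eq {D : OrientedPartition G}
    {σ : {σ : Finset V // σ ∈ D.partition.parts}} {u : V} : u ∈ σ.1 ↔ D.partOf u = σ :=
  ⟨partOf_eq, fun h => h ▸ D.mem_partOf u⟩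

lemma partSum_surjective (D : OrientedPartition G) : Function.Surjective D.partSum := by
  intro z
  refine ⟨fun i => if D.rep (D.partOf i) = i then z (D.partOf i) else 0, ?_⟩
  ext σ
  rw [partSum_apply, Finset.sum_eq_single (D.rep σ)]
  · rw [partOf_eq (D.rep_mem σ), if_pos rfl]
  · intro i hi hne
    rw [partOf_eq hi, if_neg hne.symm]
  · exact fun h => absurd (D.rep_mem σ) h

lemma finrank_ker_partSum (D : OrientedPartition G) :
    Module.finrank ℝ (LinearMap.ker D.partSum) = Fintype.card V - D.partition.parts.card := by
  have h := D.partSum.finrank_range_add_finrank_ker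
  rw [LinearMap.range_eq_top.2 D.partSum_surjective, finrank_top, Module.finrank_fintype_fun_eq_card,
    Module.finrank_fintype_fun_eq_card, Fintype.card_coe] at h
  omega

/-- A vector with vanishing sums over the parts is a combination of differences of two basis vectors
whose indices lie in the same part. -/
lemma ker_partSum_le (D : OrientedPartition G) {W : Submodule ℝ (V → ℝ)}
    (hW : ∀ u v, D.partOf u = D.partOf v → (Pi.single u 1 - Pi.single v 1 : V → ℝ) ∈ W) :
    LinearMap.ker D.partSum ≤ W := by
  intro y hy
  have hy' : ∀ σ : {σ : Finset V // σ ∈ D.partition.parts},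
      ∑ i with D.partOf i = σ, y i = 0 := by
    intro σ
    have h := congrFun (LinearMap.mem_ker.1 hy) σ
    rw [partSum_apply] at h
    refine Eq.trans (Finset.sum_congr ?_ fun _ _ => rfl) h
    ext i
    simp [mem_iff_partOf_eq]
  have hzero : ∑ i, y i • (Pi.single (D.rep (D.partOf i)) 1 : V → ℝ) = 0 := by
    rw [← Finset.sum_fiberwise Finset.univ D.partOf]
    refine Finset.sum_eq_zero fun σ _ => ?_
    rw [Finset.sum_congr rfl fun i hi => by rw [(Finset.mem_filter.1 hi).2], ← Finset.sum_smul, hy',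
      zero_smul]
  have hsum : y = ∑ i, y i • (Pi.single i 1 - Pi.single (D.rep (D.partOf i)) 1 : V → ℝ) := by
    simp_rw [smul_sub, Finset.sum_sub_distrib]
    rw [hzero, sub_zero]
    exact pi_eq_sum_univ' y
  rw [hsum]
  exact W.sum_mem fun i _ => W.smul_mem _ (hW _ _ (partOf_eq (D.rep_mem _)).symm)

end OrientedPartition

namespace PAO

/-- On the face of a p.a.o. the sums over the parts are constant, since the edges between different
parts are directed. -/
lemma partSum_load_eq {O : PAO G} {s t : V → V → ℝ} (hs : IsFracOrientation G s)
    (ht : IsFracOrientation G t) (hsO : ∀ u v, O.1.dir u v → s v u = 0)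
    (htO : ∀ u v, O.1.dir u v → t v u = 0) :
    O.oriented.partSum (load s) = O.oriented.partSum (load t) := by
  ext σ
  rw [OrientedPartition.partSum_apply, OrientedPartition.partSum_apply, hs.sum_load, ht.sum_load]
  congr 1
  refine Finset.sum_congr rfl fun v hv => Finset.sum_congr rfl fun u hu => ?_
  by_cases huv : G.Adj u v
  · rcases O.oriented_induces.partOf_eq_or_dir huv with h | h | h
    · rw [OrientedPartition.partOf_eq hv] at h
      exact absurd (OrientedPartition.mem_iff_partOf_eq.2 h) (Finset.mem_compl.1 hu)
    · linarith [hsO _ _ h, htO _ _ h, hs.add_swap u v huv, ht.add_swap u v huv]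
    · rw [hsO _ _ h, htO _ _ h]
  · rw [hs.eq_zero u v huv, ht.eq_zero u v huv]

/-- Directing an undirected edge `{u, v}` to `u` moves the center inside the face by half the
difference of the basis vectors at `u` and `v`. -/
lemma single_sub_single_mem_vectorSpan_of_adj {O : PAO G} {u v : V} (huv : G.Adj u v)
    (h1 : ¬ O.1.dir u v) (h2 : ¬ O.1.dir v u) :
    (Pi.single u 1 - Pi.single v 1 : V → ℝ) ∈ vectorSpan ℝ O.face := by
  classical
  set r : V → V → Prop := fun a b => O.1.dir a b ∨ (a = v ∧ b = u)
  have hrasymm : ∀ a b, r a b → ¬ r b a := by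
    rintro a b (hab | ⟨ha, hb⟩) (hba | ⟨hb', ha'⟩)
    · exact O.1.asymm _ _ hab hba
    · exact h1 (hb' ▸ ha' ▸ hab)
    · exact h1 (ha ▸ hb ▸ hba)
    · exact huv.ne (hb.symm.trans hb')
  have ht := isFracOrientation_halfOrientation (G := G) hrasymm
  have hmem : load (halfOrientation G r) ∈ O.face :=
    (load_mem_face_iff ht).2 fun a b hab => halfOrientation_eq_zero hrasymm (Or.inl hab)
  have hdiff : ∀ a b, halfOrientation G r a b - halfOrientation G O.1.dir a b =
      (if v = a then (if u = b then 1 / 2 else 0) else 0)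
        - (if u = a then (if v = b then 1 / 2 else 0) else 0) := by
    intro a b
    by_cases hab : v = a ∧ u = b
    · obtain ⟨rfl, rfl⟩ := hab
      simp [halfOrientation, r, h1, h2, huv.symm, huv.ne]
      norm_num
    · by_cases hba : u = a ∧ v = b
      · obtain ⟨rfl, rfl⟩ := hba
        simp [halfOrientation, r, h1, h2, huv, huv.ne, huv.ne']
      · have e1 : ¬ (a = v ∧ b = u) := fun h => hab ⟨h.1.symm, h.2.symm⟩
        have e2 : ¬ (b = v ∧ a = u) := fun h => hba ⟨h.2.symm, h.1.symm⟩
        rw [← ite_and, ← ite_and, if_neg hab, if_neg hba]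
        simp [halfOrientation, r, e1, e2]
  have hload : load (halfOrientation G r) - O.center =
      (1 / 2 : ℝ) • (Pi.single u 1 - Pi.single v 1 : V → ℝ) := by
    ext w
    simp only [center, load, Pi.sub_apply, add_sub_add_left_eq_sub, ← Finset.sum_sub_distrib, hdiff]
    rw [Finset.sum_sub_distrib]
    simp only [Finset.sum_ite_eq, Finset.mem_univ, if_true, Pi.smul_apply, Pi.sub_apply,
      Pi.single_apply, smul_eq_mul, eq_comm (a := w)]
    split_ifs <;> norm_num
  have h := vsub_mem_vectorSpan ℝ hmem O.center_mem_face
  rw [vsub_eq_sub, hload] at h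
  exact (Submodule.smul_mem_iff _ (by norm_num)).1 h

lemma single_sub_single_mem_vectorSpan {O : PAO G} {u v : V}
    (huv : O.oriented.partOf u = O.oriented.partOf v) :
    (Pi.single u 1 - Pi.single v 1 : V → ℝ) ∈ vectorSpan ℝ O.face := by
  refine SimpleGraph.rel_of_induce_connected
    (r := fun u v => (Pi.single u 1 - Pi.single v 1 : V → ℝ) ∈ vectorSpan ℝ O.face)
    (O.oriented.connected _ (O.oriented.partOf v).2) (fun u => by simp) ?_ ?_
    (huv ▸ O.oriented.mem_partOf u) (O.oriented.mem_partOf v)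
  · intro a b c hab hbc
    simpa using add_mem hab hbc
  · intro a ha b hb hab
    have e : O.oriented.partOf a = O.oriented.partOf b :=
      (OrientedPartition.partOf_eq ha).trans (OrientedPartition.partOf_eq hb).symm
    exact single_sub_single_mem_vectorSpan_of_adj hab
      (O.oriented_induces.not_dir_of_partOf_eq e) (O.oriented_induces.not_dir_of_partOf_eq e.symm)

lemma vectorSpan_face (O : PAO G) :
    vectorSpan ℝ O.face = LinearMap.ker O.oriented.partSum := by
  refine le_antisymm ?_
    (O.oriented.ker_partSum_le fun u v huv => single_sub_single_mem_vectorSpan huv)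
  rw [vectorSpan_def, Submodule.span_le]
  rintro - ⟨x, hx, y, hy, rfl⟩
  obtain ⟨s, hs, rfl⟩ := exists_load_eq_of_mem hx.1
  obtain ⟨t, ht, rfl⟩ := exists_load_eq_of_mem hy.1
  change load s - load t ∈ LinearMap.ker O.oriented.partSum
  rw [LinearMap.sub_mem_ker_iff]
  exact partSum_load_eq hs ht ((load_mem_face_iff hs).1 hx) ((load_mem_face_iff ht).1 hy)

lemma finrank_vectorSpan_face (O : PAO G) :
    Module.finrank ℝ (vectorSpan ℝ O.face) = O.dim := by
  rw [vectorSpan_face, OrientedPartition.finrank_ker_partSum, dim]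

end PAO

end Dimension

end

theorem mainTheorem2 (n : ℕ) (G : SimpleGraph (Fin n)) :
    IsPolytope (cleanZonotope G) ∧
    IsPolytopalRealization (faces (cleanZonotope G)) (PAO G) PAO.dim ∧
    cleanZonotope G =
      (1 / 2 : ℝ) • graphicalZonotope G + {(1 / 2 : ℝ) • degreeVector G + 1} :=
  ⟨isPolytope_cleanZonotope G,
    ⟨(isPolytope_cleanZonotope G).isPolytopalComplex_faces, PAO.faceEquiv G,
      fun _ _ => PAO.face_subset_face_iff.symm, PAO.finrank_vectorSpan_face⟩,
    cleanZonotope_eq G⟩
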